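/- Let $\mathbb K$ be a field, $S=\mathbb K[x_1,\dots,x_n]$ and $\mathfrak m=(x_1,\dots,x_n)$. For an ideal $J\subseteq S$, let $\overline{J}$ be its integral closure, i.e. the ideal of all $f\in S$ satisfying an equation $f^k+c_1f^{k-1}+\cdots+c_{k-1}f+c_k=0$ with $k\ge 1$ and $c_i\in J^i$. For a monomial ideal $J$, let $\mu(J)$ be the number of its minimal monomial generators. Let $I\subseteq S$ be a monomial ideal with analytic spread $\ell$, i.e. $\ell=\dim \mathcal R(I)/\mathfrak m\mathcal R(I)$ is the Krull dimension, where $\mathcal R(I)=\bigoplus_{k\ge 0}I^k$ is the Rees algebra of $I$, and let $u\in\overline{I}$ be a monomial (so $I\neq 0$ and $\ell\ge 1$). Then there is an integer $t$ with $1\le t\le \mu(\overline{I^{\ell-1}})$ and $u^t\in I^t$. -/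

import Mathlib

namespace MonomialPowers

section IntegralClosure

open Polynomial

/-- `f` is integral over the ideal `I`: there is an equation
`f ^ k + c 1 * f ^ (k - 1) + ⋯ + c (k - 1) * f + c k = 0` with `k ≥ 1` and `c i ∈ I ^ i`. -/
def IsIntegralOver {R : Type*} [CommRing R] (I : Ideal R) (f : R) : Prop :=
  ∃ (k : ℕ) (c : ℕ → R), 0 < k ∧ (∀ i, c i ∈ I ^ i) ∧
    f ^ k + ∑ i ∈ Finset.Icc 1 k, c i * f ^ (k - i) = 0

/-- Used only to see that the integral closure is an ideal: `f` is integral over `I` if and only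
if `f T` is integral over the Rees algebra `R[IT] ⊆ R[T]`. -/
theorem isIntegralOver_iff {R : Type*} [CommRing R] (I : Ideal R) (f : R) :
    IsIntegralOver I f ↔ IsIntegral (reesAlgebra I) (monomial 1 f : R[X]) := by
  constructor
  · rintro ⟨k, c, hk, hc, h⟩
    have hm : ∀ i, (monomial i (c i) : R[X]) ∈ reesAlgebra I :=
      fun i => reesAlgebra.monomial_mem.2 (hc i)
    refine ⟨X ^ k + ∑ i ∈ Finset.Icc 1 k,
      C (⟨monomial i (c i), hm i⟩ : reesAlgebra I) * X ^ (k - i), ?_, ?_⟩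
    · apply monic_X_pow_add
      refine lt_of_le_of_lt (degree_sum_le _ _) ?_
      rw [Finset.sup_lt_iff (by exact WithBot.bot_lt_coe k)]
      intro i hi
      rw [Finset.mem_Icc] at hi
      refine lt_of_le_of_lt (degree_C_mul_X_pow_le _ _) ?_
      exact_mod_cast (by omega : k - i < k)
    · rw [eval₂_add, eval₂_X_pow, eval₂_finsetSum]
      have e : ∀ i ∈ Finset.Icc 1 k,
          eval₂ (algebraMap (reesAlgebra I) R[X]) (monomial 1 f)
            (C (⟨monomial i (c i), hm i⟩ : reesAlgebra I) * X ^ (k - i))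
            = monomial k (c i * f ^ (k - i)) := by
        intro i hi
        rw [Finset.mem_Icc] at hi
        rw [eval₂_mul, eval₂_C, eval₂_X_pow, monomial_pow]
        change monomial i (c i) * _ = _
        rw [monomial_mul_monomial, show i + 1 * (k - i) = k by omega]
      rw [Finset.sum_congr rfl e, monomial_pow, one_mul, ← map_sum, ← map_add, h, map_zero]
  · rintro ⟨p, hp, h⟩
    rcases subsingleton_or_nontrivial R with hR | hR
    · exact ⟨1, 0, one_pos, fun i => by simp, Subsingleton.elim _ _⟩
    have hk : 0 < p.natDegree := by
      rw [Nat.pos_iff_ne_zero]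
      intro h0
      rw [hp.natDegree_eq_zero.1 h0, eval₂_one] at h
      exact one_ne_zero h
    refine ⟨p.natDegree, fun i => (p.coeff (p.natDegree - i) : R[X]).coeff i, hk,
      fun i => (p.coeff (p.natDegree - i)).2 i, ?_⟩
    rw [eval₂_eq_sum_range, Finset.sum_range_succ, hp.coeff_natDegree, map_one, one_mul] at h
    have h2 := congrArg (fun q : R[X] => q.coeff p.natDegree) h
    simp only [coeff_add, finsetSum_coeff, monomial_pow, one_mul, coeff_zero] at h2
    rw [coeff_monomial, if_pos rfl] at h2
    rw [← h2, add_comm]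
    congr 1
    refine Finset.sum_bij' (fun i _ => p.natDegree - i) (fun j _ => p.natDegree - j) ?_ ?_ ?_ ?_ ?_
    · intro i hi
      rw [Finset.mem_Icc] at hi
      rw [Finset.mem_range]
      omega
    · intro j hj
      rw [Finset.mem_range] at hj
      rw [Finset.mem_Icc]
      omega
    · intro i hi
      rw [Finset.mem_Icc] at hi
      omega
    · intro j hj
      rw [Finset.mem_range] at hj
      omega
    · intro i hi
      rw [Finset.mem_Icc] at hi
      obtain ⟨j, hj⟩ : ∃ j, p.natDegree = i + j := ⟨p.natDegree - i, by omega⟩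
      have e : p.natDegree - i = j := by omega
      rw [e]
      change _ = ((p.coeff j : R[X]) * monomial j (f ^ j)).coeff p.natDegree
      rw [hj, coeff_mul_monomial]
      simp only [add_tsub_cancel_left]

/-- The integral closure of the ideal `I`: the ideal of all elements integral over `I`. -/
def integralClosure {R : Type*} [CommRing R] (I : Ideal R) : Ideal R where
  carrier := {f | IsIntegralOver I f}
  zero_mem' := by
    change IsIntegralOver I 0
    rw [isIntegralOver_iff, map_zero]
    exact isIntegral_zero
  add_mem' := by
    intro f g hf hg
    change IsIntegralOver I _ at hf hg
    change IsIntegralOver I _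
    rw [isIntegralOver_iff] at *
    rw [map_add]
    exact hf.add hg
  smul_mem' := by
    intro r f hf
    change IsIntegralOver I _ at hf
    change IsIntegralOver I _
    rw [isIntegralOver_iff] at *
    have e : (monomial 1 (r • f) : R[X]) =
        algebraMap (reesAlgebra I) R[X] (algebraMap R (reesAlgebra I) r) * monomial 1 f := by
      change _ = C r * monomial 1 f
      rw [C_mul_monomial, smul_eq_mul]
    rw [e]
    exact isIntegral_algebraMap.mul hf

end IntegralClosure

open MvPolynomial

/-- `I` is a monomial ideal: it is generated by monomials. -/
def IsMonomialIdeal {n : ℕ} {K : Type*} [Field K] (I : Ideal (MvPolynomial (Fin n) K)) : Prop :=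
  ∃ A : Set (Fin n →₀ ℕ), I = Ideal.span ((fun a => monomial a (1 : K)) '' A)

/-- The exponents of the minimal monomial generators of a monomial ideal `I`, that is, of the
monomials in `I` that are minimal with respect to divisibility. -/
def minimalGenerators {n : ℕ} {K : Type*} [Field K] (I : Ideal (MvPolynomial (Fin n) K)) :
    Set (Fin n →₀ ℕ) :=
  {a | Minimal (fun b => monomial b (1 : K) ∈ I) a}

/-- The number `μ(I)` of minimal monomial generators of a monomial ideal `I`. -/
noncomputable def mu {n : ℕ} {K : Type*} [Field K] (I : Ideal (MvPolynomial (Fin n) K)) : ℕ :=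
  (minimalGenerators I).ncard

/-- The analytic spread of `I`: the Krull dimension of the fiber ring `𝓡(I) / 𝔪 𝓡(I)`, where
`𝓡(I)` is the Rees algebra and `𝔪 = (x₁, …, xₙ)`. -/
noncomputable def analyticSpread {n : ℕ} {K : Type*} [Field K]
    (I : Ideal (MvPolynomial (Fin n) K)) : WithBot ℕ∞ :=
  ringKrullDim (reesAlgebra I ⧸
    (idealOfVars (Fin n) K).map (algebraMap (MvPolynomial (Fin n) K) (reesAlgebra I)))

end MonomialPowers

namespace MonomialPowers

/-! Let `v i` be the exponents of finitely many monomial generators of `I`. A monomial with exponent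
`b` is integral over `I ^ k` exactly when some real weights `μ i ≥ 0` of total `k` satisfy `∑ μ i *
v i ≤ b`. Minimising first the degree of this combination and then its support makes the support `S`
a set of affinely independent points in a compact face of the Newton polyhedron
(`exists_weights_isFaceSimplex`). The corresponding elements of the Rees algebra are algebraically
independent in the fiber ring, so `|S| ≤ ℓ` (`IsFaceSimplex.card_le_analyticSpread`).

If the total weight is `ℓ ≥ 1`, some weight is therefore at least 1, and one copy of that generator
can be split off: the closure of `I ^ ℓ` is `I` times the closure of `I ^ (ℓ - 1)`
(`exists_add_eq_of_mem_closureExponents`). So for each minimal generator `x` of the latter, `u x` is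
a multiple of a generator of `I` times another minimal generator `y`. Iterating `x ↦ y` on the
finite set of minimal generators reaches a cycle, of length `t` at most their number. Multiplying
around the cycle and cancelling gives `u ^ t ∈ I ^ t` (`exists_nsmul_mem_powerExponents`). -/

/-! ### Krull dimension and algebraic independence -/

/-- Lying over lifts the bottom prime of a chain, and going up lifts the rest. -/
theorem ringKrullDim_le_of_isIntegral_of_injective {R S : Type*} [CommRing R] [CommRing S]
    (f : R →+* S) (hf : f.IsIntegral) (hinj : Function.Injective f) :
    ringKrullDim R ≤ ringKrullDim S := by
  algebraize [f]
  have : FaithfulSMul R S := (faithfulSMul_iff_algebraMap_injective R S).2 hinj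
  refine iSup_le fun l => ?_
  obtain ⟨P, hP, hPl⟩ := Ideal.exists_ideal_over_prime_of_isIntegral (S := S) l.head.asIdeal ⊥
    ((Ideal.comap_bot_of_injective (algebraMap R S) hinj).trans_le bot_le)
  obtain ⟨hP, hPl⟩ := hPl
  have : P.LiesOver l.head.asIdeal := ⟨hPl.symm⟩
  obtain ⟨L, hL, -⟩ := Ideal.exists_ltSeries_of_hasGoingUp l P
  rw [← hL]
  exact le_iSup (fun L : LTSeries (PrimeSpectrum S) => ((L.length : ℕ) : WithBot ℕ∞)) L

/-- A finitely generated domain over a field that contains `r` algebraically independent elements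
has Krull dimension at least `r`. -/
theorem card_le_ringKrullDim_of_isDomain {K A σ : Type*} [Field K] [CommRing A] [IsDomain A]
    [Algebra K A] [Algebra.FiniteType K A] [Finite σ] (f : MvPolynomial σ K →ₐ[K] A)
    (hf : Function.Injective f) : (Nat.card σ : WithBot ℕ∞) ≤ ringKrullDim A := by
  -- Noether normalization: `s` bounds the dimension from below and equals the transcendence degree,
  -- which bounds the number of independent elements.
  obtain ⟨s, g, hg, hgi⟩ := exists_integral_inj_algHom_of_fg K A
  have hdim := ringKrullDim_le_of_isIntegral_of_injective g.toRingHom hgi hg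
  rw [MvPolynomial.ringKrullDim_of_isNoetherianRing, ringKrullDim_eq_zero_of_field, zero_add,
    Nat.card_fin] at hdim
  refine le_trans ?_ hdim
  have hx : AlgebraicIndependent K (fun i => g (MvPolynomial.X i)) :=
    (MvPolynomial.algebraicIndependent_X (Fin s) K).map' hg
  have hbasis : IsTranscendenceBasis K (fun i => g (MvPolynomial.X i)) := by
    have hr : Algebra.adjoin K (Set.range fun i => g (MvPolynomial.X i)) = g.range := by
      rw [← Algebra.map_top, ← MvPolynomial.adjoin_range_X, AlgHom.map_adjoin, ← Set.range_comp]
      rfl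
    rw [hx.isTranscendenceBasis_iff_isAlgebraic]
    rw [hr]
    have : Algebra.IsIntegral g.range A := by
      refine ⟨fun a => ?_⟩
      obtain ⟨p, hp, h⟩ := hgi a
      refine ⟨p.map g.rangeRestrict.toRingHom, hp.map _, ?_⟩
      rw [Polynomial.eval₂_map]
      exact h
    infer_instance
  have hy : AlgebraicIndependent K (fun i => f (MvPolynomial.X i)) :=
    (MvPolynomial.algebraicIndependent_X σ K).map' hf
  have h1 := hy.lift_cardinalMk_le_trdeg
  have h2 := hbasis.lift_cardinalMk_eq_trdeg
  have : Fintype σ := Fintype.ofFinite σ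
  rw [Cardinal.mk_fin, Cardinal.lift_natCast, Cardinal.lift_uzero] at h2
  rw [← h2, Cardinal.lift_natCast, Cardinal.mk_fintype, Cardinal.lift_natCast,
    Nat.cast_le] at h1
  rw [Nat.card_eq_fintype_card]
  exact_mod_cast h1

/-- A finitely generated algebra over a field that contains `r` algebraically independent elements
has Krull dimension at least `r`. -/
theorem card_le_ringKrullDim {K A σ : Type*} [Field K] [CommRing A]
    [Algebra K A] [Algebra.FiniteType K A] [Finite σ] (f : MvPolynomial σ K →ₐ[K] A)
    (hf : Function.Injective f) : (Nat.card σ : WithBot ℕ∞) ≤ ringKrullDim A := by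
  -- Some prime `P` contracts to zero, so the polynomial ring still embeds in the domain `A ⧸ P`.
  obtain ⟨P, hP, hPf⟩ := Ideal.exists_comap_eq_of_mem_minimalPrimes_of_injective
    (f := f.toRingHom) hf ⊥ (by rw [IsDomain.minimalPrimes_eq_singleton_bot]; rfl)
  refine le_trans (card_le_ringKrullDim_of_isDomain ((Ideal.Quotient.mkₐ K P).comp f) ?_)
    (ringKrullDim_le_of_surjective (Ideal.Quotient.mk P) Ideal.Quotient.mk_surjective)
  rw [injective_iff_map_eq_zero]
  intro p hp
  have : p ∈ Ideal.comap f.toRingHom P :=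
    Ideal.mem_comap.2 (Ideal.Quotient.eq_zero_iff_mem.1 hp)
  rwa [hPf] at this

/-! ### Convex geometry of exponents -/

section Exponents

variable {ι : Type*} [Fintype ι] {n : ℕ}

/-- The exponents of the monomials in the `k`-th power of the ideal generated by the monomials
with exponents `v i`. -/
def powerExponents (v : ι → Fin n →₀ ℕ) (k : ℕ) : Set (Fin n →₀ ℕ) :=
  {b | ∃ m : ι → ℕ, ∑ i, m i = k ∧ ∑ i, m i • v i ≤ b}

/-- The exponents of the monomials in the integral closure of the `k`-th power of the ideal
generated by the monomials with exponents `v i`. -/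
def closureExponents (v : ι → Fin n →₀ ℕ) (k : ℕ) : Set (Fin n →₀ ℕ) :=
  {b | ∃ N : ℕ, 0 < N ∧ N • b ∈ powerExponents v (N * k)}

/-- A linear system with natural coefficients that has a nonnegative real solution has, after
scaling, a natural one. -/
theorem mem_closureExponents_of_real (v : ι → Fin n →₀ ℕ) (k : ℕ) (c : Fin n →₀ ℕ) (μ : ι → ℝ)
    (hμ : ∀ i, 0 ≤ μ i) (hsum : ∑ i, μ i = k) (hle : ∀ j, ∑ i, μ i * v i j ≤ c j) :
    c ∈ closureExponents v k := by
  have hfloor : ∀ (N : ℕ) (i : ι), (⌊N * μ i⌋₊ : ℝ) ≤ N * μ i := fun N i =>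
    Nat.floor_le (mul_nonneg N.cast_nonneg (hμ i))
  have hlt : ∀ (N : ℕ) (i : ι), N * μ i < (⌊N * μ i⌋₊ : ℝ) + 1 := fun N i => Nat.lt_floor_add_one _
  have h1 : ∀ (N : ℕ) j, ∑ i, ⌊N * μ i⌋₊ * v i j ≤ N * c j := by
    intro N j
    have : ∑ i, (⌊N * μ i⌋₊ : ℝ) * v i j ≤ N * c j := by
      calc _ ≤ ∑ i, N * μ i * v i j := Finset.sum_le_sum fun i _ =>
              mul_le_mul_of_nonneg_right (hfloor N i) (Nat.cast_nonneg _)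
        _ = N * ∑ i, μ i * v i j := by simp only [Finset.mul_sum, mul_assoc]
        _ ≤ _ := mul_le_mul_of_nonneg_left (hle j) N.cast_nonneg
    exact_mod_cast this
  have h2 : ∀ N : ℕ, ∑ i, ⌊N * μ i⌋₊ ≤ N * k := by
    intro N
    have : ∑ i, (⌊N * μ i⌋₊ : ℝ) ≤ N * k := by
      rw [← hsum, Finset.mul_sum]
      exact Finset.sum_le_sum fun i _ => hfloor N i
    exact_mod_cast this
  have h3 : ∀ N : ℕ, N * k ≤ ∑ i, ⌊N * μ i⌋₊ + Fintype.card ι := by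
    intro N
    have : (N : ℝ) * k ≤ ∑ i, (⌊N * μ i⌋₊ : ℝ) + Fintype.card ι := by
      rw [← hsum, Finset.mul_sum]
      calc _ ≤ ∑ i, ((⌊N * μ i⌋₊ : ℝ) + 1) := Finset.sum_le_sum fun i _ => (hlt N i).le
        _ = _ := by simp [Finset.sum_add_distrib]
    exact_mod_cast this
  -- Dickson's lemma on the slacks of the rounded-down multiples of `μ`: the difference of the
  -- roundings for `M` and `N` solves the system scaled by `M - N`. The last two entries have
  -- constant sum, so both are equal at `N` and `M`, which makes the total weight exact.
  obtain ⟨N, M, hNM, hle1, hle2, hle3⟩ := wellQuasiOrdered_le (α := (Fin n → ℕ) × ℕ × ℕ)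
    fun N => (fun j => N * c j - ∑ i, ⌊N * μ i⌋₊ * v i j, N * k - ∑ i, ⌊N * μ i⌋₊,
      ∑ i, ⌊N * μ i⌋₊ + Fintype.card ι - N * k)
  have hmono : ∀ i, ⌊N * μ i⌋₊ ≤ ⌊M * μ i⌋₊ := fun i =>
    Nat.floor_mono (mul_le_mul_of_nonneg_right (by exact_mod_cast hNM.le) (hμ i))
  choose d hd using fun i => Nat.exists_eq_add_of_le (hmono i)
  obtain ⟨D, rfl⟩ := Nat.exists_eq_add_of_lt hNM
  refine ⟨D + 1, D.succ_pos, d, ?_, ?_⟩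
  · have hN := h2 N
    have hM := h2 (N + D + 1)
    have hN' := h3 N
    have hM' := h3 (N + D + 1)
    simp only [hd, Finset.sum_add_distrib] at hle2 hle3 hM hM'
    have e : (N + D + 1) * k = N * k + (D + 1) * k := by ring
    rw [e] at hle2 hle3 hM hM'
    omega
  · intro j
    have h4 := hle1 j
    have hN := h1 N j
    have hM := h1 (N + D + 1) j
    simp only [hd, add_mul, Finset.sum_add_distrib] at h4 hM
    simp only [Finsupp.finsetSum_apply, Finsupp.smul_apply, smul_eq_mul, add_mul]
    omega

/-- The key property of a set of exponents spanning a simplex in a compact face of the Newton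
polyhedron. -/
structure IsFaceSimplex (v : ι → Fin n →₀ ℕ) (S : Finset ι) : Prop where
  eq_of_sum_eq : ∀ p q : ι → ℕ, (∀ i ∉ S, p i = 0) → (∀ i ∉ S, q i = 0) →
    ∑ i, p i = ∑ i, q i → ∑ i, p i • v i = ∑ i, q i • v i → p = q
  sum_eq_of_sum_le : ∀ p q : ι → ℕ, (∀ i ∉ S, p i = 0) → ∑ i, p i = ∑ i, q i →
    ∑ i, q i • v i ≤ ∑ i, p i • v i → ∑ i, q i • v i = ∑ i, p i • v i

/-- The weights of the convex combinations, scaled by `k`, of the points `v i` that lie below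
`b`. -/
def weights (v : ι → Fin n →₀ ℕ) (k : ℕ) (b : Fin n →₀ ℕ) : Set (ι → ℝ) :=
  {μ | (∀ i, 0 ≤ μ i) ∧ ∑ i, μ i = k ∧ ∀ j, ∑ i, μ i * v i j ≤ b j}

theorem isCompact_weights (v : ι → Fin n →₀ ℕ) (k : ℕ) (b : Fin n →₀ ℕ) :
    IsCompact (weights v k b) := by
  refine IsCompact.of_isClosed_subset (isCompact_Icc (a := (0 : ι → ℝ)) (b := fun _ => (k : ℝ)))
    ?_ ?_
  · have h1 : IsClosed {μ : ι → ℝ | ∀ i, 0 ≤ μ i} := isClosed_Ici (a := (0 : ι → ℝ))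
    have h2 : IsClosed {μ : ι → ℝ | ∑ i, μ i = k} := isClosed_eq (by fun_prop) (by fun_prop)
    have h3 : IsClosed {μ : ι → ℝ | ∀ j, ∑ i, μ i * v i j ≤ b j} := by
      simp only [Set.ofPred_forall]
      exact isClosed_iInter fun j => isClosed_le (by fun_prop) (by fun_prop)
    exact h1.inter (h2.inter h3)
  · rintro μ ⟨h0, h1, -⟩
    refine ⟨h0, fun i => ?_⟩
    rw [← h1]
    exact Finset.single_le_sum (fun i _ => h0 i) (Finset.mem_univ i)

theorem weights_nonempty {v : ι → Fin n →₀ ℕ} {k : ℕ} {b : Fin n →₀ ℕ}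
    (hb : b ∈ closureExponents v k) : (weights v k b).Nonempty := by
  obtain ⟨N, hN, m, hm, hle⟩ := hb
  have hN' : (0 : ℝ) < N := by exact_mod_cast hN
  refine ⟨fun i => m i / N, fun i => by positivity, ?_, fun j => ?_⟩
  · rw [← Finset.sum_div, div_eq_iff hN'.ne', mul_comm]
    exact_mod_cast hm
  · have h := hle j
    simp only [Finsupp.finsetSum_apply, Finsupp.smul_apply, smul_eq_mul] at h
    simp only [div_mul_eq_mul_div]
    rw [← Finset.sum_div, div_le_iff₀ hN', mul_comm]
    exact_mod_cast h

/-- A minimal solution with minimal support is supported on a simplex in a compact face. -/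
theorem exists_weights_isFaceSimplex {v : ι → Fin n →₀ ℕ} {k : ℕ} {b : Fin n →₀ ℕ}
    (hb : b ∈ closureExponents v k) :
    ∃ μ ∈ weights v k b, ∃ S : Finset ι, (∀ i, i ∈ S ↔ μ i ≠ 0) ∧ IsFaceSimplex v S := by
  classical
  let φ : (ι → ℝ) → ℝ := fun μ => ∑ j, ∑ i, μ i * v i j
  have hφ : Continuous φ := by fun_prop
  obtain ⟨μ₀, hμ₀, hmin₀⟩ := (isCompact_weights v k b).exists_isMinOn (weights_nonempty hb)
    hφ.continuousOn
  let T : Set (ι → ℝ) := {μ | μ ∈ weights v k b ∧ φ μ ≤ φ μ₀}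
  let s : (ι → ℝ) → ℕ := fun μ => (Finset.univ.filter fun i => μ i ≠ 0).card
  obtain ⟨μ, ⟨hμ, hμ'⟩, hsupp⟩ : ∃ μ ∈ T, ∀ μ' ∈ T, s μ ≤ s μ' := by
    have hT : T.Nonempty := ⟨μ₀, hμ₀, le_rfl⟩
    obtain ⟨μ, h1, h2⟩ := (InvImage.wf s wellFounded_lt).has_min T hT
    exact ⟨μ, h1, fun μ' h' => not_lt.1 (h2 μ' h')⟩
  have hmin : ∀ μ' ∈ weights v k b, φ μ ≤ φ μ' := fun μ' h => hμ'.trans (hmin₀ h)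
  obtain ⟨h0, h1, h2⟩ := hμ
  refine ⟨μ, ⟨h0, h1, h2⟩, Finset.univ.filter fun i => μ i ≠ 0, by simp, ?_, ?_⟩
  · intro p q hp hq hpq hv
    by_contra hne
    -- An affine relation on the support: moving `μ` along `g` changes neither the total weight nor
    -- the combination.
    let g : ι → ℝ := fun i => (p i : ℝ) - q i
    have hg0 : ∀ i, μ i = 0 → g i = 0 := by
      intro i hi
      simp only [g]
      rw [hp i (by simpa using hi), hq i (by simpa using hi), sub_self]
    have hgs : ∑ i, g i = 0 := by
      simp only [g, Finset.sum_sub_distrib]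
      rw [sub_eq_zero]
      exact_mod_cast hpq
    have hgv : ∀ j, ∑ i, g i * v i j = 0 := by
      intro j
      simp only [g, sub_mul, Finset.sum_sub_distrib]
      rw [sub_eq_zero]
      have := DFunLike.congr_fun hv j
      simp only [Finsupp.finsetSum_apply, Finsupp.smul_apply, smul_eq_mul] at this
      exact_mod_cast this
    obtain ⟨i₁, -, hi₁⟩ : ∃ i ∈ Finset.univ, g i < 0 := by
      by_contra! hge
      have := (Finset.sum_eq_zero_iff_of_nonneg hge).1 hgs
      refine hne (funext fun i => ?_)
      have := this i (Finset.mem_univ i)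
      simp only [g, sub_eq_zero] at this
      exact_mod_cast this
    -- The first weight to vanish along `g`; stopping there shrinks the support, against its
    -- minimality.
    obtain ⟨i₀, hi₀, hi₀'⟩ := Finset.exists_min_image (Finset.univ.filter fun i => g i < 0)
      (fun i => μ i / -g i) ⟨i₁, by simpa using hi₁⟩
    simp only [Finset.mem_filter, Finset.mem_univ, true_and] at hi₀ hi₀'
    set ε := μ i₀ / -g i₀ with hε
    have hε0 : 0 ≤ ε := div_nonneg (h0 _) (by linarith)
    let μ' : ι → ℝ := fun i => μ i + ε * g i
    have hμ'v : ∀ j, ∑ i, μ' i * v i j = ∑ i, μ i * v i j := by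
      intro j
      simp only [μ', add_mul, Finset.sum_add_distrib, mul_assoc, ← Finset.mul_sum, hgv, mul_zero,
        add_zero]
    have hμ'T : μ' ∈ T := by
      refine ⟨⟨fun i => ?_, ?_, fun j => (hμ'v j).trans_le (h2 j)⟩, ?_⟩
      · rcases lt_or_ge (g i) 0 with hi | hi
        · have := hi₀' i hi
          rw [le_div_iff₀ (by linarith)] at this
          simp only [μ']
          linarith
        · exact add_nonneg (h0 i) (mul_nonneg hε0 hi)
      · simp only [μ', Finset.sum_add_distrib, ← Finset.mul_sum, hgs, mul_zero, add_zero, h1]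
      · simpa only [φ, hμ'v] using hμ'
    refine absurd (hsupp μ' hμ'T) (not_le.2 (Finset.card_lt_card ?_))
    refine (Finset.ssubset_iff_of_subset fun i hi => ?_).2 ⟨i₀, ?_, ?_⟩
    · simp only [Finset.mem_filter, Finset.mem_univ, true_and] at hi ⊢
      intro h
      exact hi (by simp only [μ', h, hg0 i h, mul_zero, add_zero])
    · simp only [Finset.mem_filter, Finset.mem_univ, true_and]
      intro h
      exact hi₀.ne (hg0 _ h)
    · simp only [Finset.mem_filter, Finset.mem_univ, true_and, not_not, μ', hε]
      have : g i₀ ≠ 0 := hi₀.ne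
      field_simp
      ring
  · intro p q hp hpq hle
    -- A small multiple of `p` can be exchanged for `q` within the weights; a strict decrease in any
    -- coordinate would contradict the minimality of `φ μ`.
    obtain ⟨ε, hε, hε0⟩ : ∃ ε : ℝ, (∀ i, ε * p i ≤ μ i) ∧ 0 < ε := by
      have : ∀ᶠ ε : ℝ in nhdsWithin 0 (Set.Ioi 0), ∀ i, ε * p i ≤ μ i := by
        rw [Filter.eventually_all]
        intro i
        rcases (h0 i).eq_or_lt with h | h
        · refine Filter.Eventually.of_forall fun ε => ?_
          rw [hp i (by simpa using h.symm), ← h]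
          simp
        · have ht : Filter.Tendsto (fun ε : ℝ => ε * p i) (nhdsWithin 0 (Set.Ioi 0))
              (nhds (0 * p i)) :=
            ((continuous_id.mul continuous_const).tendsto 0).mono_left nhdsWithin_le_nhds
          rw [zero_mul] at ht
          filter_upwards [ht.eventually_lt_const h] with ε hε using hε.le
      exact (this.and self_mem_nhdsWithin).exists
    have hle' : ∀ j, ∑ i, (q i : ℝ) * v i j ≤ ∑ i, (p i : ℝ) * v i j := by
      intro j
      have := hle j
      simp only [Finsupp.finsetSum_apply, Finsupp.smul_apply, smul_eq_mul] at this
      exact_mod_cast this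
    let μ' : ι → ℝ := fun i => μ i + ε * (q i - p i)
    have hμ'v : ∀ j, ∑ i, μ' i * v i j =
        ∑ i, μ i * v i j + ε * (∑ i, (q i : ℝ) * v i j - ∑ i, (p i : ℝ) * v i j) := by
      intro j
      simp only [μ', Finset.mul_sum, ← Finset.sum_sub_distrib, ← Finset.sum_add_distrib]
      exact Finset.sum_congr rfl fun i _ => by ring
    have hφ' : φ μ ≤ φ μ' := by
      refine hmin _ ⟨fun i => ?_, ?_, fun j => ?_⟩
      · have := hε i
        have : 0 ≤ ε * (q i : ℝ) := by positivity
        simp only [μ', mul_sub]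
        linarith
      · simp only [μ', Finset.sum_add_distrib, ← Finset.mul_sum, Finset.sum_sub_distrib]
        rw [h1, ← Nat.cast_sum, ← Nat.cast_sum, hpq]
        ring
      · rw [hμ'v]
        have := mul_nonneg hε0.le (sub_nonneg.2 (hle' j))
        linarith [h2 j]
    simp only [φ, hμ'v, Finset.sum_add_distrib, ← Finset.mul_sum] at hφ'
    have h4 : 0 ≤ ∑ j, (∑ i, (q i : ℝ) * v i j - ∑ i, (p i : ℝ) * v i j) := by
      by_contra! h
      have := mul_neg_of_pos_of_neg hε0 h
      linarith
    ext j
    rw [Finset.sum_sub_distrib, sub_nonneg] at h4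
    have := (Finset.sum_eq_sum_iff_of_le fun j _ => hle' j).1
      (le_antisymm (Finset.sum_le_sum fun j _ => hle' j) h4) j (Finset.mem_univ j)
    simp only [Finsupp.finsetSum_apply, Finsupp.smul_apply, smul_eq_mul]
    exact_mod_cast this

/-- If every simplex in a compact face of the Newton polyhedron has at most `k + 1` vertices, then
the integral closure of the power `k + 1` of a monomial ideal is the product of the ideal and the
integral closure of its power `k`. -/
theorem exists_add_eq_of_mem_closureExponents {v : ι → Fin n →₀ ℕ} {k : ℕ} {b : Fin n →₀ ℕ}
    (hv : ∀ S : Finset ι, IsFaceSimplex v S → S.card ≤ k + 1)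
    (hb : b ∈ closureExponents v (k + 1)) :
    ∃ i, ∃ c ∈ closureExponents v k, v i + c = b := by
  classical
  obtain ⟨μ, ⟨h0, h1, h2⟩, S, hS, hface⟩ := exists_weights_isFaceSimplex hb
  have hsum : ∑ i ∈ S, μ i = (k + 1 : ℕ) := by
    rw [← h1]
    exact Finset.sum_subset (Finset.subset_univ S) fun i _ hi => by simpa [hS] using hi
  obtain ⟨i, hi⟩ : ∃ i, 1 ≤ μ i := by
    -- Weights all below 1 would give `k + 1 < |S|`.
    by_contra! hlt
    have hne : S.Nonempty := by
      by_contra hS0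
      rw [Finset.not_nonempty_iff_eq_empty] at hS0
      rw [hS0, Finset.sum_empty] at hsum
      exact absurd hsum.symm (by positivity)
    have h3 : ∑ i ∈ S, μ i < ∑ i ∈ S, 1 := Finset.sum_lt_sum_of_nonempty hne fun i _ => hlt i
    rw [hsum, Finset.sum_const, nsmul_one, Nat.cast_lt] at h3
    exact absurd (hv S hface) (not_le.2 h3)
  have hib : ∀ j, (v i j : ℝ) ≤ b j := by
    intro j
    refine le_trans ?_ ((Finset.single_le_sum (f := fun i => μ i * (v i j : ℝ))
      (fun i _ => mul_nonneg (h0 i) (Nat.cast_nonneg _)) (Finset.mem_univ i)).trans (h2 j))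
    exact le_mul_of_one_le_left (Nat.cast_nonneg _) hi
  have hib' : v i ≤ b := fun j => by exact_mod_cast hib j
  refine ⟨i, b - v i, ?_, add_tsub_cancel_of_le hib'⟩
  refine mem_closureExponents_of_real v k _ (fun l => μ l - if l = i then 1 else 0) ?_ ?_ ?_
  · intro l
    split_ifs with h
    · rw [h]
      linarith
    · rw [sub_zero]
      exact h0 l
  · rw [Finset.sum_sub_distrib, h1]
    simp
  · intro j
    rw [Finsupp.tsub_apply, Nat.cast_sub (hib' j)]
    simp only [sub_mul, Finset.sum_sub_distrib, ite_mul, one_mul, zero_mul, Finset.sum_ite_eq',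
      Finset.mem_univ, if_true]
    linarith [h2 j]

theorem add_mem_closureExponents {v : ι → Fin n →₀ ℕ} {k l : ℕ} {b c : Fin n →₀ ℕ}
    (hb : b ∈ closureExponents v k) (hc : c ∈ closureExponents v l) :
    b + c ∈ closureExponents v (k + l) := by
  obtain ⟨N, hN, p, hp, hle⟩ := hb
  obtain ⟨M, hM, q, hq, hle'⟩ := hc
  refine ⟨N * M, Nat.mul_pos hN hM, fun i => M * p i + N * q i, ?_, ?_⟩
  · rw [Finset.sum_add_distrib, ← Finset.mul_sum, ← Finset.mul_sum, hp, hq]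
    ring
  · simp only [add_smul, mul_smul, Finset.sum_add_distrib, ← Finset.smul_sum, smul_add]
    refine add_le_add ?_ ?_
    · rw [smul_comm N M b]
      exact nsmul_le_nsmul_right hle M
    · exact nsmul_le_nsmul_right hle' N

theorem finite_setOf_minimal (P : (Fin n →₀ ℕ) → Prop) : {b | Minimal P b}.Finite :=
  WellQuasiOrderedLE.finite_of_isAntichain (setOfPred_minimal_antichain P)

/-- The monomial version of the determinant trick. -/
theorem exists_nsmul_mem_powerExponents {v : ι → Fin n →₀ ℕ} {k : ℕ} {u : Fin n →₀ ℕ}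
    (hv : ∀ S : Finset ι, IsFaceSimplex v S → S.card ≤ k + 1)
    (hu : u ∈ closureExponents v 1) :
    ∃ t : ℕ, 1 ≤ t ∧ t ≤ {b | Minimal (· ∈ closureExponents v k) b}.ncard ∧
      t • u ∈ powerExponents v t := by
  classical
  set V : Set (Fin n →₀ ℕ) := {b | Minimal (· ∈ closureExponents v k) b} with hV
  have hVfin : V.Finite := finite_setOf_minimal _
  have hmin : ∀ c ∈ closureExponents v k, ∃ b ∈ V, b ≤ c := by
    intro c hc
    obtain ⟨b, hbc, hb⟩ := exists_minimal_le_of_wellFoundedLT (· ∈ closureExponents v k) c hc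
    exact ⟨b, hb, hbc⟩
  obtain ⟨x₀, hx₀⟩ : V.Nonempty := by
    obtain ⟨N, hN, m, hm, -⟩ := hu
    obtain ⟨i, -, -⟩ := Finset.exists_ne_zero_of_sum_ne_zero (s := Finset.univ) (f := m)
      (by rw [hm]; omega)
    obtain ⟨b, hb, -⟩ := hmin (k • v i) ⟨1, one_pos, Pi.single i k, by simp, by
      rw [Finset.sum_eq_single i (fun j _ hj => by simp [hj]) (by simp)]
      simp⟩
    exact ⟨b, hb⟩
  have hstep : ∀ x : V, ∃ y : V, ∃ i, v i + y ≤ u + x := by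
    rintro ⟨x, hx⟩
    have h := add_mem_closureExponents hu hx.prop
    rw [add_comm 1 k] at h
    obtain ⟨i, c, hc, h⟩ := exists_add_eq_of_mem_closureExponents hv h
    obtain ⟨y, hy, hyc⟩ := hmin c hc
    exact ⟨⟨y, hy⟩, i, h ▸ add_le_add_right hyc (v i)⟩
  choose f g hfg using hstep
  -- Telescoping: the intermediate minimal generators cancel along the orbit of `x`.
  have key : ∀ (t : ℕ) (x : V),
      ∃ m : ι → ℕ, ∑ i, m i = t ∧ ∑ i, m i • v i + (f^[t] x : Fin n →₀ ℕ) ≤ t • u + x := by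
    intro t
    induction t with
    | zero => exact fun x => ⟨0, by simp, by simp⟩
    | succ t ih =>
      intro x
      obtain ⟨m, hm, hle⟩ := ih (f x)
      refine ⟨m + Pi.single (g x) 1, by simp [Finset.sum_add_distrib, hm], ?_⟩
      have e : ∑ i, (Pi.single (g x) 1 : ι → ℕ) i • v i = v (g x) := by
        rw [Finset.sum_eq_single (g x) (fun j _ hj => by simp [hj]) (by simp)]
        simp
      simp only [Pi.add_apply, add_smul, Finset.sum_add_distrib, e, Function.iterate_succ_apply,
        one_smul]
      calc _ = (∑ i, m i • v i + (f^[t] (f x) : Fin n →₀ ℕ)) + v (g x) := by abel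
        _ ≤ t • u + f x + v (g x) := by gcongr
        _ = t • u + (v (g x) + f x) := by abel
        _ ≤ t • u + (u + x) := add_le_add_right (hfg x) _
        _ = _ := by abel
  have : Fintype V := hVfin.fintype
  -- Pigeonhole on iterates `0` to `V.ncard`, so that the period `s - r` is at most `V.ncard`.
  obtain ⟨r, hr, s, hs, hrs, heq⟩ := Finset.exists_ne_map_eq_of_card_lt_of_maps_to
    (s := Finset.range (V.ncard + 1)) (t := Finset.univ) (f := fun t => f^[t] ⟨x₀, hx₀⟩)
    (by rw [Finset.card_range, Finset.card_univ, ← Nat.card_eq_fintype_card,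
      Nat.card_coe_set_eq]; omega)
    (fun _ _ => Finset.mem_coe.2 (Finset.mem_univ _))
  wlog hlt : r < s generalizing r s
  · exact this s hs r hr hrs.symm heq.symm (by omega)
  rw [Finset.mem_range] at hs
  refine ⟨s - r, by omega, by omega, ?_⟩
  obtain ⟨m, hm, hle⟩ := key (s - r) (f^[r] ⟨x₀, hx₀⟩)
  rw [← Function.iterate_add_apply, Nat.sub_add_cancel hlt.le] at hle
  rw [← heq] at hle
  exact ⟨m, hm, le_of_add_le_add_right hle⟩

end Exponents

/-! ### Monomial ideals, integral closure and the fiber ring -/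

section MonomialIdeals

open MvPolynomial

variable {K : Type*} [Field K] {n : ℕ} {ι : Type*} [Fintype ι]

theorem span_monomial_pow (v : ι → Fin n →₀ ℕ) (k : ℕ) :
    Ideal.span (Set.range fun i => monomial (v i) (1 : K)) ^ k =
      Ideal.span ((fun b => monomial b (1 : K)) '' {b | ∃ m : ι → ℕ, ∑ i, m i = k ∧
        ∑ i, m i • v i = b}) := by
  classical
  induction k with
  | zero =>
    rw [pow_zero, Ideal.one_eq_top, eq_comm, Ideal.eq_top_iff_one]
    exact Ideal.subset_span ⟨0, ⟨0, by simp, by simp⟩, rfl⟩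
  | succ k ih =>
    rw [pow_succ, ih, Ideal.span_mul_span']
    apply le_antisymm
    · rw [Ideal.span_le]
      rintro _ ⟨_, ⟨_, ⟨m, hm, rfl⟩, rfl⟩, _, ⟨i, rfl⟩, rfl⟩
      refine Ideal.subset_span ⟨∑ i, m i • v i + v i, ⟨m + Pi.single i 1, ?_, ?_⟩, ?_⟩
      · simp [Finset.sum_add_distrib, hm]
      · simp only [Pi.add_apply, add_smul, Finset.sum_add_distrib]
        rw [Finset.sum_eq_single (f := fun j => (Pi.single i 1 : ι → ℕ) j • v j) i
          (fun j _ hj => by simp [hj]) (by simp)]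
        simp
      · simp [monomial_mul]
    · rw [Ideal.span_le]
      rintro _ ⟨_, ⟨m, hm, rfl⟩, rfl⟩
      obtain ⟨i, -, hi⟩ := Finset.exists_ne_zero_of_sum_ne_zero (s := Finset.univ) (f := m)
        (by rw [hm]; omega)
      have hmi : m = Function.update m i (m i - 1) + Pi.single i 1 := by
        ext j
        rcases eq_or_ne j i with rfl | hj
        · simp only [Pi.add_apply, Function.update_self, Pi.single_eq_same]
          omega
        · simp [hj]
      generalize Function.update m i (m i - 1) = m' at hmi
      subst hmi
      refine Ideal.subset_span ⟨_, ⟨_, ⟨m', ?_, rfl⟩, rfl⟩, _, ⟨i, rfl⟩, ?_⟩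
      · simpa [Finset.sum_add_distrib] using hm
      · simp only [Pi.add_apply, add_smul, Finset.sum_add_distrib]
        rw [Finset.sum_eq_single (f := fun j => (Pi.single i 1 : ι → ℕ) j • v j) i
          (fun j _ hj => by simp [hj]) (by simp)]
        simp [monomial_mul]

theorem mem_span_monomial_pow_iff (v : ι → Fin n →₀ ℕ) (k : ℕ) (f : MvPolynomial (Fin n) K) :
    f ∈ Ideal.span (Set.range fun i => monomial (v i) (1 : K)) ^ k ↔
      ∀ b ∈ f.support, b ∈ powerExponents v k := by
  rw [span_monomial_pow, mem_ideal_span_monomial_image]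
  refine forall₂_congr fun b _ => ⟨?_, ?_⟩
  · rintro ⟨_, ⟨m, hm, rfl⟩, hle⟩
    exact ⟨m, hm, hle⟩
  · rintro ⟨m, hm, hle⟩
    exact ⟨_, ⟨m, hm, rfl⟩, hle⟩

theorem monomial_mem_span_monomial_pow_iff (v : ι → Fin n →₀ ℕ) (k : ℕ) (b : Fin n →₀ ℕ) :
    monomial b (1 : K) ∈ Ideal.span (Set.range fun i => monomial (v i) (1 : K)) ^ k ↔
      b ∈ powerExponents v k := by
  classical
  rw [mem_span_monomial_pow_iff, support_monomial, if_neg one_ne_zero]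
  simp

/-- The extra variable makes the divisibility strict, which a compact face forbids. -/
theorem exists_single_add_le_of_mem_idealOfVars_mul (v : ι → Fin n →₀ ℕ) (k : ℕ)
    {f : MvPolynomial (Fin n) K}
    (hf : f ∈ idealOfVars (Fin n) K * Ideal.span (Set.range fun i => monomial (v i) (1 : K)) ^ k)
    {b : Fin n →₀ ℕ} (hb : b ∈ f.support) :
    ∃ (j : Fin n) (m : ι → ℕ), ∑ i, m i = k ∧ Finsupp.single j 1 + ∑ i, m i • v i ≤ b := by
  have hle : idealOfVars (Fin n) K * Ideal.span (Set.range fun i => monomial (v i) (1 : K)) ^ k ≤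
      Ideal.span ((fun b => monomial b (1 : K)) '' {b | ∃ (j : Fin n) (m : ι → ℕ), ∑ i, m i = k ∧
        Finsupp.single j 1 + ∑ i, m i • v i = b}) := by
    rw [span_monomial_pow, idealOfVars, Ideal.span_mul_span', Ideal.span_le]
    rintro _ ⟨_, ⟨j, rfl⟩, _, ⟨_, ⟨m, hm, rfl⟩, rfl⟩, rfl⟩
    refine Ideal.subset_span ⟨_, ⟨j, m, hm, rfl⟩, ?_⟩
    simp [X, monomial_mul]
  obtain ⟨_, ⟨j, m, hm, rfl⟩, h⟩ := mem_ideal_span_monomial_image.1 (hle hf) b hb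
  exact ⟨j, m, hm, h⟩

theorem monomial_mem_integralClosure_iff (v : ι → Fin n →₀ ℕ) (k : ℕ) (b : Fin n →₀ ℕ) :
    monomial b (1 : K) ∈
        integralClosure (Ideal.span (Set.range fun i => monomial (v i) (1 : K)) ^ k) ↔
      b ∈ closureExponents v k := by
  classical
  constructor
  · rintro ⟨d, c, hd, hc, h⟩
    -- The leading term contributes 1 to this coefficient, so some `c i` must contain the monomial
    -- `i • b` to cancel it.
    have h' := congrArg (coeff (d • b)) h
    simp only [monomial_pow, one_pow, coeff_add, coeff_sum, coeff_zero, coeff_monomial,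
      if_true] at h'
    obtain ⟨i, hi, hne⟩ := Finset.exists_ne_zero_of_sum_ne_zero
      (fun h0 => one_ne_zero (α := K) (by rwa [h0, add_zero] at h'))
    rw [Finset.mem_Icc] at hi
    have e : d • b = i • b + (d - i) • b := by rw [← add_smul, Nat.add_sub_cancel' hi.2]
    rw [e, coeff_mul_monomial, mul_one] at hne
    refine ⟨i, hi.1, ?_⟩
    have := hc i
    rw [← pow_mul, mul_comm k i, mem_span_monomial_pow_iff] at this
    exact this _ (mem_support_iff.2 hne)
  · rintro ⟨N, hN, h⟩
    rw [← monomial_mem_span_monomial_pow_iff (K := K), mul_comm, pow_mul] at h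
    -- The pure equation `f ^ N + c N = 0`.
    refine ⟨N, fun i => if i = N then -monomial (N • b) 1 else 0, hN, fun i => ?_, ?_⟩
    · beta_reduce
      split_ifs with hi
      · rw [hi]
        exact neg_mem h
      · exact zero_mem _
    · simp only [ite_mul, zero_mul]
      rw [Finset.sum_ite_eq', if_pos (Finset.mem_Icc.2 ⟨hN, le_rfl⟩)]
      simp [monomial_pow]

/-- Reduces vanishing in the fiber ring to a condition in each degree. -/
theorem coeff_mem_of_mem_map_reesAlgebra {R : Type*} [CommRing R] {I J : Ideal R}
    {x : reesAlgebra I} (hx : x ∈ J.map (algebraMap R (reesAlgebra I))) (d : ℕ) :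
    (x : Polynomial R).coeff d ∈ J * I ^ d := by
  induction hx using Submodule.span_induction generalizing d with
  | mem x h =>
    obtain ⟨r, hr, rfl⟩ := h
    change (Polynomial.C r).coeff d ∈ _
    rw [Polynomial.coeff_C]
    split_ifs with hd
    · rw [hd, pow_zero, mul_one]
      exact hr
    · exact zero_mem _
  | zero => exact zero_mem _
  | add x y _ _ hx hy =>
    change ((x : Polynomial R) + y).coeff d ∈ _
    rw [Polynomial.coeff_add]
    exact add_mem (hx d) (hy d)
  | smul a x _ hx =>
    change ((a : Polynomial R) * x).coeff d ∈ _
    rw [Polynomial.coeff_mul]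
    refine sum_mem fun p hp => ?_
    rw [Finset.HasAntidiagonal.mem_antidiagonal] at hp
    rw [← hp, pow_add, mul_left_comm]
    exact Ideal.mul_mem_mul (a.2 p.1) (hx p.2)

theorem prod_monomial_monomial {R σ α : Type*} [CommSemiring R] (s : Finset α) (d : α → ℕ)
    (e : α → σ →₀ ℕ) :
    ∏ i ∈ s, Polynomial.monomial (d i) (monomial (e i) (1 : R)) =
      Polynomial.monomial (∑ i ∈ s, d i) (monomial (∑ i ∈ s, e i) 1) := by
  classical
  induction s using Finset.induction_on with
  | empty => rfl
  | insert i s hi ih =>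
    rw [Finset.prod_insert hi, ih, Polynomial.monomial_mul_monomial, monomial_mul, one_mul,
      Finset.sum_insert hi, Finset.sum_insert hi]

/-- The vertices of a simplex in a compact face of the Newton polyhedron give algebraically
independent elements of the fiber ring. -/
theorem IsFaceSimplex.card_le_analyticSpread {v : ι → Fin n →₀ ℕ} {S : Finset ι}
    (hS : IsFaceSimplex v S) :
    (S.card : WithBot ℕ∞) ≤
      analyticSpread (Ideal.span (Set.range fun i => monomial (v i) (1 : K))) := by
  classical
  set I := Ideal.span (Set.range fun i => monomial (v i) (1 : K)) with hI
  set m := (idealOfVars (Fin n) K).map (algebraMap (MvPolynomial (Fin n) K) (reesAlgebra I))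
    with hm
  have hmem : ∀ i : S, (Polynomial.monomial 1 (monomial (v i) (1 : K))) ∈ reesAlgebra I := by
    intro i
    rw [reesAlgebra.monomial_mem, pow_one]
    exact Ideal.subset_span ⟨i, rfl⟩
  let ψ : MvPolynomial S K →ₐ[K] reesAlgebra I := aeval fun i => ⟨_, hmem i⟩
  let ext : (S →₀ ℕ) → ι → ℕ := fun p i => if h : i ∈ S then p ⟨i, h⟩ else 0
  have hext : ∀ p, ∀ i ∉ S, ext p i = 0 := fun p i hi => dif_neg hi
  have hinj : Function.Injective ext := by
    intro p q h
    ext i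
    simpa [ext] using congrFun h i
  have hψ : ∀ (p : S →₀ ℕ) (c : K), ((ψ (monomial p c) : reesAlgebra I) :
      Polynomial (MvPolynomial (Fin n) K)) =
        Polynomial.monomial (∑ i, ext p i) (monomial (∑ i, ext p i • v i) c) := by
    intro p c
    have e1 : ∀ i : S, ext p i = p i := fun i => dif_pos i.2
    have e2 : ∑ i, ext p i = ∑ i : S, p i := by
      rw [← Finset.sum_subset (Finset.subset_univ S) fun i _ hi => hext p i hi,
        ← Finset.sum_coe_sort]
      exact Finset.sum_congr rfl fun i _ => e1 i
    have e3 : ∑ i, ext p i • v i = ∑ i : S, p i • v i := by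
      rw [← Finset.sum_subset (Finset.subset_univ S) fun i _ hi => by rw [hext p i hi, zero_smul],
        ← Finset.sum_coe_sort]
      exact Finset.sum_congr rfl fun i _ => by rw [e1 i]
    rw [e2, e3, aeval_monomial, Finsupp.prod_fintype _ _ fun i => pow_zero _, MulMemClass.coe_mul,
      SubmonoidClass.coe_finsetProd]
    simp only [SubmonoidClass.coe_pow, Polynomial.monomial_pow, monomial_pow, one_mul, one_pow]
    rw [prod_monomial_monomial]
    change Polynomial.C (C c) * _ = _
    rw [Polynomial.C_mul_monomial, C_mul_monomial, mul_one]
  have hfin : Algebra.FiniteType K (reesAlgebra I ⧸ m) :=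
    have : Algebra.FiniteType K (reesAlgebra I) :=
      Algebra.FiniteType.trans (S := MvPolynomial (Fin n) K) inferInstance inferInstance
    Algebra.FiniteType.of_surjective (Ideal.Quotient.mkₐ K m) Ideal.Quotient.mk_surjective
  have := card_le_ringKrullDim (A := reesAlgebra I ⧸ m) ((Ideal.Quotient.mkₐ K m).comp ψ) ?_
  · rw [Nat.card_eq_fintype_card, Fintype.card_coe] at this
    exact this
  rw [injective_iff_map_eq_zero]
  intro f hf
  by_contra hne
  obtain ⟨p, hp⟩ := support_nonempty.2 hne
  have hf' : ψ f ∈ m := Ideal.Quotient.eq_zero_iff_mem.1 hf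
  have hcoeff := coeff_mem_of_mem_map_reesAlgebra hf' (∑ i, ext p i)
  -- By affine independence, distinct exponents of `f` have distinct images, so nothing cancels.
  have hsupp : ∑ i, ext p i • v i ∈ ((ψ f : Polynomial (MvPolynomial (Fin n) K)).coeff
      (∑ i, ext p i)).support := by
    have e : (ψ f : Polynomial (MvPolynomial (Fin n) K)) = ∑ q ∈ f.support,
        Polynomial.monomial (∑ i, ext q i) (monomial (∑ i, ext q i • v i) (coeff q f)) := by
      conv_lhs => rw [f.as_sum, map_sum, AddSubmonoidClass.coe_finsetSum]
      exact Finset.sum_congr rfl fun q _ => hψ q _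
    rw [mem_support_iff, e, Polynomial.finsetSum_coeff, coeff_sum, Finset.sum_eq_single p]
    · rw [Polynomial.coeff_monomial, if_pos rfl, coeff_monomial, if_pos rfl]
      exact mem_support_iff.1 hp
    · intro q _ hqp
      rw [Polynomial.coeff_monomial]
      split_ifs with h1
      · rw [coeff_monomial, if_neg]
        intro h2
        exact hqp (hinj (hS.eq_of_sum_eq _ _ (hext q) (hext p) h1 h2))
      · exact coeff_zero _
    · exact fun h => absurd hp h
  obtain ⟨j, q, hq, hle⟩ := exists_single_add_le_of_mem_idealOfVars_mul v _ hcoeff hsupp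
  -- The face condition forces equality, but coordinate `j` was strictly smaller.
  have h1 := hS.sum_eq_of_sum_le _ q (hext p) hq.symm (le_trans le_add_self hle)
  have h2 := hle j
  rw [← h1, Finsupp.add_apply, Finsupp.single_eq_same] at h2
  omega

theorem IsMonomialIdeal.exists_finite {I : Ideal (MvPolynomial (Fin n) K)}
    (hI : IsMonomialIdeal I) :
    ∃ A : Finset (Fin n →₀ ℕ),
      I = Ideal.span (Set.range fun i : A => monomial (i : Fin n →₀ ℕ) 1) := by
  classical
  obtain ⟨A, rfl⟩ := hI
  obtain ⟨T, hTA, hT⟩ := Submodule.fg_span_iff_fg_span_finset_subset _ |>.1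
    (IsNoetherian.noetherian (Ideal.span ((fun a => monomial a (1 : K)) '' A)))
  obtain ⟨B, -, rfl⟩ := Finset.subset_set_image_iff.1 hTA
  refine ⟨B, hT.trans ?_⟩
  rw [Finset.coe_image, Set.image_eq_range]
  rfl

end MonomialIdeals

end MonomialPowers

/-! ### The main theorem -/

theorem lemma4p4 {K : Type*} [Field K] (n : ℕ) (I : Ideal (MvPolynomial (Fin n) K))
    (hI : MonomialPowers.IsMonomialIdeal I)
    (ℓ : ℕ) (hℓ : MonomialPowers.analyticSpread I = (ℓ : WithBot ℕ∞))
    (a : Fin n →₀ ℕ)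
    (ha : MvPolynomial.monomial a (1 : K) ∈ MonomialPowers.integralClosure I) :
    ∃ t : ℕ, 1 ≤ t ∧ t ≤ MonomialPowers.mu (MonomialPowers.integralClosure (I ^ (ℓ - 1))) ∧
      (MvPolynomial.monomial a (1 : K)) ^ t ∈ I ^ t := by
  obtain ⟨A, rfl⟩ := hI.exists_finite
  rw [← pow_one (Ideal.span _), MonomialPowers.monomial_mem_integralClosure_iff] at ha
  -- With truncated subtraction `ℓ - 1 + 1` is at least `ℓ`, so `ℓ = 0` needs no separate case.
  have hv : ∀ S : Finset A, MonomialPowers.IsFaceSimplex (fun i : A => (i : Fin n →₀ ℕ)) S →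
      S.card ≤ ℓ - 1 + 1 := by
    intro S hS
    have h := hS.card_le_analyticSpread (K := K)
    rw [hℓ] at h
    have h' : S.card ≤ ℓ := by exact_mod_cast h
    omega
  obtain ⟨t, ht, hle, hmem⟩ := MonomialPowers.exists_nsmul_mem_powerExponents hv ha
  refine ⟨t, ht, ?_, ?_⟩
  · simpa only [MonomialPowers.mu, MonomialPowers.minimalGenerators,
      MonomialPowers.monomial_mem_integralClosure_iff] using hle
  · rwa [MvPolynomial.monomial_pow, one_pow, MonomialPowers.monomial_mem_span_monomial_pow_iff]
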